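/- Let $1\le k\le n$ be integers and let $A$ be a complex $n\times n$ matrix. For $m\ge 1$ let $\mathcal X_m$ be the set of complex $n\times m$ matrices $X$ with $X^*X=I_m$, and let $\mathcal Y_m=\{XX^*: X\in\mathcal X_m\}$. For a square complex matrix $B$ let $F(B)=\{x^*Bx : x^*x=1\}$ be its numerical range, let $$\Lambda_k(A)=\{\lambda\in\mathbb C : X^*AX=\lambda I_k \text{ for some } X\in\mathcal X_k\},\qquad r_k(A)=\max\{|z| : z\in\partial\Lambda_k(A)\}$$ be the $k$-rank numerical range and the $k$-rank numerical radius of $A$, with the convention that a maximum or supremum over the empty set is $0$. Let $(M_p)_{p\in\mathbb N}$ be a sequence in $\mathcal X_{n-k+1}$, where $\mathbb N=\{0,1,2,\dots\}$, and put $\mathcal J_\nu(A)=\bigcap_{p\le\nu}F(M_p^*AM_p)$ for $\nu\in\mathbb N$. Suppose that (a) the projections $M_pM_p^*$, $p\in\mathbb N$, are dense in $\mathcal Y_{n-k+1}$ (a condition that does not involve $A$), or (b) $\Lambda_k(A)=\bigcap_{p\in\mathbb N}F(M_p^*AM_p)$. Then $\Lambda_k(A)=\bigcap_{p\in\mathbb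 N}F(M_p^*AM_p)$, the maximum that defines $r_k(A)$ is attained if $\Lambda_k(A)\neq\emptyset$, every $\mathcal J_\nu(A)$ is bounded, and $$r_k(A)=\lim_{\nu\to\infty}\sup\{|z| : z\in\mathcal J_\nu(A)\}=\inf_{\nu\in\mathbb N}\sup\{|z| : z\in\mathcal J_\nu(A)\}.$$ Moreover, sequences in $\mathcal X_{n-k+1}$ with property (a) exist. -/

import Mathlib

open scoped Matrix

noncomputable section

/-- The set of `n × m` complex isometries: matrices `X` with `X* X = I_m`. -/
def isometryMatrices (n m : ℕ) : Set (Matrix (Fin n) (Fin m) ℂ) :=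
  {X | Xᴴ * X = 1}

/-- The set of rank-`m` orthogonal projections `X X*` of `ℂⁿ`, with `X` an `n × m` isometry. -/
def rankProjections (n m : ℕ) : Set (Matrix (Fin n) (Fin n) ℂ) :=
  {P | ∃ X ∈ isometryMatrices n m, P = X * Xᴴ}

/-- The `k`-rank numerical range: all `l` with `X* A X = l I_k` for some `n × k` isometry `X`. -/
def rankNumericalRange {n : ℕ} (k : ℕ) (A : Matrix (Fin n) (Fin n) ℂ) : Set ℂ :=
  {l | ∃ X ∈ isometryMatrices n k, Xᴴ * A * X = l • (1 : Matrix (Fin k) (Fin k) ℂ)}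

/-- The classical numerical range `F(B) = {x* B x : x* x = 1}`. -/
def numericalRange {m : ℕ} (B : Matrix (Fin m) (Fin m) ℂ) : Set ℂ :=
  {z | ∃ x : Fin m → ℂ, star x ⬝ᵥ x = 1 ∧ z = star x ⬝ᵥ (B *ᵥ x)}

/-- The `k`-rank numerical radius: the supremum (a maximum, if the `k`-rank numerical range is
nonempty; `0` if it is empty) of `|z|` over the boundary of the `k`-rank numerical range. -/
def rankNumericalRadius {n : ℕ} (k : ℕ) (A : Matrix (Fin n) (Fin n) ℂ) : ℝ :=
  sSup ((fun z : ℂ => ‖z‖) '' frontier (rankNumericalRange k A))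

/-- The intersection of the numerical ranges `F(M_p* A M_p)` over `p ≤ ν`. The index starts at
`0`, so that at least one numerical range is always present. -/
def compressionIntersection {n m : ℕ} (M : ℕ → Matrix (Fin n) (Fin m) ℂ)
    (A : Matrix (Fin n) (Fin n) ℂ) (ν : ℕ) : Set ℂ :=
  ⋂ p ≤ ν, numericalRange ((M p)ᴴ * A * M p)

/-- The number `sup {|z| : z ∈ J_ν(A)}`. -/
def compressionRadius {n m : ℕ} (M : ℕ → Matrix (Fin n) (Fin m) ℂ)
    (A : Matrix (Fin n) (Fin n) ℂ) (ν : ℕ) : ℝ :=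
  sSup ((fun z : ℂ => ‖z‖) '' compressionIntersection M A ν)

/-- The projections `M_p M_p*` are dense in the set of all rank-`m` orthogonal projections
(entrywise topology, which is also that of the operator norm). -/
def HasDenseProjections {n m : ℕ} (M : ℕ → Matrix (Fin n) (Fin m) ℂ) : Prop :=
  rankProjections n m ⊆ closure (Set.range fun p => M p * (M p)ᴴ)

end

open scoped InnerProductSpace

noncomputable section

/-! The core is the Li–Sze theorem `mem_rankNumericalRange_iff`: `Λ_k(A)` is the intersection of
`F(M* A M)` over all isometries `M` with `n - k + 1` columns. One inclusion holds because subspaces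
of dimensions `k` and `n - k + 1` meet. For the other, put `B = A - l`. If every compression has `0`
in its numerical range, then no rotation `c B` has a negative definite real part on a subspace of
dimension `n - k + 1`. From this bound a `k`-dimensional subspace on which the form of `B` vanishes
is constructed (`NegDefBound.exists_isotropic`).

The construction is by induction on the dimension. Some nonzero `x` always makes the functionals `⟪T
x, ·⟫` and `⟪x, T ·⟫` linearly dependent. If such an `x` is isotropic, it is split off and the bound
for `k + 1` becomes the bound for `k`. If no such `x` is isotropic, splitting them off one after
another diagonalizes the form by congruence, with nonzero diagonal entries. In the diagonal case,
counting negative real parts over all rotations gives interlacing inequalities between the slopes of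
the positive and of the negative entries. The Fan–Pall theorem turns them into an isometry, whose
suitably scaled graph is totally isotropic.

Membership in `F(M* A M)` depends only on the projection `M M*` and is a closed condition on it, so
a dense sequence of projections gives the same intersection. The sets `J_ν` are compact and decrease
to `Λ_k(A)`, hence their maximal moduli converge to that of `Λ_k(A)`, which is attained on the
boundary. -/

theorem isClosed_setOf_exists_mem_isCompact {X Y : Type*} [TopologicalSpace X]
    [TopologicalSpace Y] {K : Set Y} (hK : IsCompact K) {s : Set (X × Y)} (hs : IsClosed s) :
    IsClosed {x | ∃ y ∈ K, (x, y) ∈ s} := by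
  have : CompactSpace K := isCompact_iff_compactSpace.mp hK
  have h := isClosedMap_fst_of_compactSpace (X := X) (Y := K)
    ((fun q : X × K => (q.1, (q.2 : Y))) ⁻¹' s) (hs.preimage (by fun_prop))
  convert h using 1
  ext x
  simp

/-! ### Converse of Cauchy interlacing -/

/-- Divided differences of order `p` annihilate polynomials of degree less than `p`. -/
theorem sum_eval_div_prod_eq_zero {p : ℕ} (a : Fin (p + 1) → ℝ) (ha : Function.Injective a)
    (Q : Polynomial ℝ) (hQ : Q.degree < p) :
    ∑ j, Q.eval (a j) / ∏ i : Fin p, (a j - a (j.succAbove i)) = 0 := by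
  have h := Lagrange.coeff_eq_sum (s := Finset.univ) (v := a) ha.injOn (P := Q)
    (by simpa using hQ.trans (by exact_mod_cast Nat.lt_succ_self p))
  simp only [Finset.card_univ, Fintype.card_fin, Nat.add_sub_cancel] at h
  rw [Polynomial.coeff_eq_zero_of_degree_lt hQ] at h
  rw [h]
  refine Finset.sum_congr rfl fun j _ => ?_
  congr 1
  rw [← Finset.compl_singleton, ← Fin.image_succAbove_univ,
    Finset.prod_image (Fin.succAbove_right_injective.injOn)]

/-- The weights `w j` are the residues of `∏ (x - b i) / ∏ (x - a j) = ∑ w j / (x - a j)`; strict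
interlacing makes them positive. The vectors `v i = (√(w j) / (a j - b i))_j` are orthogonal to
`√w`, because `b i` is a zero of this function, and to each other, by partial fractions. Since
`diag(a) v i = b i • v i + √w`, normalizing them gives the columns of `T`. -/
theorem exists_compression_of_strict_interlacing {p : ℕ} (a : Fin (p + 1) → ℝ) (b : Fin p → ℝ)
    (h₁ : ∀ i, a i.castSucc < b i) (h₂ : ∀ i, b i < a i.succ) :
    ∃ T : Matrix (Fin (p + 1)) (Fin p) ℝ,
      Tᵀ * T = 1 ∧ Tᵀ * Matrix.diagonal a * T = Matrix.diagonal b := by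
  have ha : StrictMono a := Fin.strictMono_iff_lt_succ.2 fun i => (h₁ i).trans (h₂ i)
  set w : Fin (p + 1) → ℝ := fun j => ∏ i : Fin p, ((a j - b i) / (a j - a (j.succAbove i))) with hw
  have hwpos : ∀ j, 0 < w j := by
    intro j
    refine Finset.prod_pos fun i _ => ?_
    rcases lt_or_ge i.castSucc j with h | h
    · rw [Fin.succAbove_of_castSucc_lt _ _ h]
      have h3 : a i.succ ≤ a j := ha.monotone (Fin.castSucc_lt_iff_succ_le.1 h)
      exact div_pos (by linarith [h₂ i]) (by linarith [h₁ i, h₂ i])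
    · rw [Fin.succAbove_of_le_castSucc _ _ h]
      have h3 : a j ≤ a i.castSucc := ha.monotone h
      exact div_pos_of_neg_of_neg (by linarith [h₁ i]) (by linarith [h₁ i, h₂ i])
  have hne : ∀ j i, a j - b i ≠ 0 := by
    intro j i
    rcases lt_or_ge i.castSucc j with h | h
    · have h3 : a i.succ ≤ a j := ha.monotone (Fin.castSucc_lt_iff_succ_le.1 h)
      exact (sub_pos.2 ((h₂ i).trans_le h3)).ne'
    · have h3 : a j ≤ a i.castSucc := ha.monotone h
      exact (sub_neg.2 (h3.trans_lt (h₁ i))).ne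
  have hsum : ∀ i, ∑ j, w j / (a j - b i) = 0 := by
    intro i
    have hdeg : (∏ l ∈ Finset.univ.erase i, (Polynomial.X - Polynomial.C (b l))).degree <
        (p : WithBot ℕ) := by
      rw [Polynomial.degree_prod]
      simp only [Polynomial.degree_X_sub_C, Finset.sum_const, Finset.card_erase_of_mem
        (Finset.mem_univ i), Finset.card_univ, Fintype.card_fin, nsmul_eq_mul, mul_one]
      have := i.pos
      exact_mod_cast Nat.sub_lt this one_pos
    rw [← sum_eval_div_prod_eq_zero a ha.injective _ hdeg]
    refine Finset.sum_congr rfl fun j _ => ?_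
    rw [hw]
    simp only [Finset.prod_div_distrib, Polynomial.eval_prod, Polynomial.eval_sub,
      Polynomial.eval_X, Polynomial.eval_C]
    rw [← Finset.mul_prod_erase _ _ (Finset.mem_univ i)]
    field_simp [hne j i]
  have hnn : ∀ i, 0 < ∑ j, w j / (a j - b i) ^ 2 := fun i =>
    Finset.sum_pos (fun j _ => div_pos (hwpos j) (by have := hne j i; positivity))
      Finset.univ_nonempty
  have horth : ∀ i l, i ≠ l → ∑ j, w j / ((a j - b i) * (a j - b l)) = 0 := by
    intro i l hil
    have hb : StrictMono b := fun x y hxy =>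
      (h₂ x).trans_le ((ha.monotone (Fin.succ_le_castSucc_iff.2 hxy)).trans (h₁ y).le)
    have hbne : b i - b l ≠ 0 := sub_ne_zero.2 (hb.injective.ne hil)
    have : (b i - b l) * ∑ j, w j / ((a j - b i) * (a j - b l)) = 0 := by
      have h0 : ∑ j, w j / (a j - b i) - ∑ j, w j / (a j - b l) = 0 := by simp [hsum]
      rw [Finset.mul_sum, ← h0, ← Finset.sum_sub_distrib]
      refine Finset.sum_congr rfl fun j _ => ?_
      field_simp [hne j i, hne j l]
      ring
    exact (mul_eq_zero.1 this).resolve_left hbne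
  set ν : Fin p → ℝ := fun i => √(∑ j, w j / (a j - b i) ^ 2)
  have hν : ∀ i, 0 < ν i := fun i => Real.sqrt_pos.2 (hnn i)
  have hν2 : ∀ i, ν i * ν i = ∑ j, w j / (a j - b i) ^ 2 := fun i => Real.mul_self_sqrt (hnn i).le
  have key : ∀ i l, ∑ j, √(w j) / (a j - b i) / ν i * (√(w j) / (a j - b l) / ν l) =
      if i = l then 1 else 0 := by
    intro i l
    have : ∑ j, √(w j) / (a j - b i) / ν i * (√(w j) / (a j - b l) / ν l) =
        (∑ j, w j / ((a j - b i) * (a j - b l))) / (ν i * ν l) := by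
      rw [Finset.sum_div]
      refine Finset.sum_congr rfl fun j _ => ?_
      field_simp [hne j i, hne j l, (hν i).ne', (hν l).ne']
      rw [Real.sq_sqrt (hwpos j).le]
    rw [this]
    split_ifs with h
    · subst h
      rw [hν2]
      simp only [← sq]
      exact div_self (hnn i).ne'
    · rw [horth i l h, zero_div]
  refine ⟨Matrix.of fun j i => √(w j) / (a j - b i) / ν i, ?_, ?_⟩
  · ext i l
    simp only [Matrix.mul_apply, Matrix.transpose_apply, Matrix.of_apply, Matrix.one_apply]
    exact key i l
  · ext i l
    rw [Matrix.mul_apply]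
    simp only [Matrix.mul_diagonal, Matrix.transpose_apply, Matrix.of_apply,
      Matrix.diagonal_apply]
    have h1 : ∀ j, √(w j) / (a j - b i) / ν i * a j * (√(w j) / (a j - b l) / ν l) =
        b i * (√(w j) / (a j - b i) / ν i * (√(w j) / (a j - b l) / ν l)) +
          w j / (a j - b l) / (ν i * ν l) := by
      intro j
      field_simp [hne j i, hne j l, (hν i).ne', (hν l).ne']
      rw [Real.sq_sqrt (hwpos j).le]
      ring
    simp only [h1]
    rw [Finset.sum_add_distrib, ← Finset.mul_sum, key, ← Finset.sum_div, hsum]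
    simp

theorem isCompact_setOf_transpose_mul_self_eq_one (m n : Type*) [Fintype m] [Fintype n]
    [DecidableEq n] : IsCompact {T : Matrix m n ℝ | Tᵀ * T = 1} := by
  have hK : IsCompact (Set.pi Set.univ fun _ : m => Set.pi Set.univ fun _ : n =>
      Set.Icc (-1 : ℝ) 1) :=
    isCompact_univ_pi fun _ => isCompact_univ_pi fun _ => isCompact_Icc
  refine hK.of_isClosed_subset
    (isClosed_eq (f := fun T : Matrix m n ℝ => Tᵀ * T) (by fun_prop) continuous_const) ?_
  intro (T : Matrix m n ℝ) hT i _ j _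
  have h : ∑ x, T x j * T x j = 1 := by
    simpa [Matrix.mul_apply] using congrFun (congrFun (show Tᵀ * T = 1 from hT) j) j
  have h2 : T i j * T i j ≤ 1 := h ▸ Finset.single_le_sum (f := fun x => T x j * T x j)
    (fun x _ => mul_self_nonneg _) (Finset.mem_univ i)
  constructor <;> nlinarith

/-- The converse of Cauchy interlacing, for hyperplane compressions. -/
theorem exists_compression_of_interlacing {p : ℕ} (a : Fin (p + 1) → ℝ) (b : Fin p → ℝ)
    (h₁ : ∀ i, a i.castSucc ≤ b i) (h₂ : ∀ i, b i ≤ a i.succ) :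
    ∃ T : Matrix (Fin (p + 1)) (Fin p) ℝ,
      Tᵀ * T = 1 ∧ Tᵀ * Matrix.diagonal a * T = Matrix.diagonal b := by
  -- Shifting `a j` by `2 j η` and `b i` by `(2 i + 1) η` makes the interlacing strict for `η > 0`.
  -- The set of `η` for which a compression exists is closed, since the isometries are compact, so
  -- it contains `0`.
  have hc := isClosed_setOf_exists_mem_isCompact
    (isCompact_setOf_transpose_mul_self_eq_one (Fin (p + 1)) (Fin p))
    (s := {q : ℝ × Matrix (Fin (p + 1)) (Fin p) ℝ |
      q.2ᵀ * Matrix.diagonal (fun j => a j + q.1 * (2 * (j : ℕ))) * q.2 =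
        Matrix.diagonal (fun i => b i + q.1 * (2 * (i : ℕ) + 1))})
    (isClosed_eq (by fun_prop) (by fun_prop))
  have h0 : (0 : ℝ) ∈ closure (Set.Ioi 0) := by simp
  have := (hc.closure_subset_iff (s := Set.Ioi 0)).2 ?_ h0
  · simpa using this
  · intro η hη
    have hη : 0 < η := hη
    obtain ⟨T, hT, hT'⟩ := exists_compression_of_strict_interlacing
      (fun j => a j + η * (2 * (j : ℕ))) (fun i => b i + η * (2 * (i : ℕ) + 1))
      (fun i => by have := h₁ i; simp only [Fin.val_castSucc]; linarith)
      (fun i => by have := h₂ i; simp only [Fin.val_succ]; push_cast; linarith)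
    exact ⟨T, hT, hT'⟩

/-- The Fan-Pall theorem: the converse of Cauchy interlacing for real diagonal matrices. -/
theorem exists_compression_of_interlacing_add (p r : ℕ) (a b : ℕ → ℝ)
    (ha : ∀ i, i + 1 < p + r → a i ≤ a (i + 1)) (hb : ∀ i j, i ≤ j → j < p → b i ≤ b j)
    (h₁ : ∀ i < p, a i ≤ b i) (h₂ : ∀ i < p, b i ≤ a (i + r)) :
    ∃ T : Matrix (Fin (p + r)) (Fin p) ℝ, Tᵀ * T = 1 ∧
      Tᵀ * Matrix.diagonal (fun j : Fin (p + r) => a j) * T =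
        Matrix.diagonal (fun i : Fin p => b i) := by
  induction r generalizing a with
  | zero =>
    refine ⟨1, by simp, ?_⟩
    simp only [Nat.add_zero, Matrix.transpose_one, one_mul, mul_one]
    congr 1
    ext i
    exact le_antisymm (h₁ i i.2) (h₂ i i.2)
  | succ r ih =>
    -- `c` is the least sequence with `a i ≤ c i` and `b i ≤ c (i + r)`. It interlaces `a` in
    -- codimension one, while `b` interlaces `c` with gap `r`.
    set c : ℕ → ℝ := fun i => if r ≤ i then max (a i) (b (i - r)) else a i with hc
    have hac : ∀ i, a i ≤ c i := fun i => by
      simp only [hc]; split_ifs <;> simp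
    have hca : ∀ i, i < p + r → c i ≤ a (i + 1) := by
      intro i hi
      simp only [hc]
      split_ifs with h
      · refine max_le (ha i (by omega)) ?_
        have := h₂ (i - r) (by omega)
        rwa [show i - r + (r + 1) = i + 1 by omega] at this
      · exact ha i (by omega)
    obtain ⟨T, hT, hT'⟩ := ih c (fun i hi => (hca i (by omega)).trans (hac _))
      (fun i hi => by
        simp only [hc]
        split_ifs with h
        · exact max_le (h₁ i hi) (hb _ _ (by omega) hi)
        · exact h₁ i hi)
      (fun i hi => by simp [hc])
    obtain ⟨S, hS, hS'⟩ := exists_compression_of_interlacing (p := p + r)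
      (fun j => a j) (fun i => c i) (fun i => by simpa using hac i)
      (fun i => by simpa using hca i i.2)
    refine ⟨S * T, ?_, ?_⟩
    · rw [Matrix.transpose_mul, Matrix.mul_assoc, ← Matrix.mul_assoc Sᵀ, hS, Matrix.one_mul, hT]
    · rw [← hT', ← hS', Matrix.transpose_mul]
      simp only [Matrix.mul_assoc]
      rfl

/-! ### Negative definite subspaces and isotropic vectors -/

section SesquilinearForm

variable {E : Type*} [NormedAddCommGroup E] [InnerProductSpace ℂ E]

/-- The form `Re (c ⟪x, T x⟫)` is negative definite on `N`. -/
def IsNegDefOn (T : E →ₗ[ℂ] E) (c : ℂ) (N : Submodule ℂ E) : Prop :=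
  ∀ x ∈ N, x ≠ 0 → (c * ⟪x, T x⟫_ℂ).re < 0

/-- For every rotation `c T`, a subspace of `U` on which `c T` has negative definite real part has
codimension at least `k` in `U`. -/
def NegDefBound (T : E →ₗ[ℂ] E) (U : Submodule ℂ E) (k : ℕ) : Prop :=
  ∀ c : ℂ, ∀ N ≤ U, IsNegDefOn T c N → Module.finrank ℂ N + k ≤ Module.finrank ℂ U

/-- The form `⟪x, T y⟫` vanishes on `V`. -/
def IsTotallyIsotropic (T : E →ₗ[ℂ] E) (V : Submodule ℂ E) : Prop :=
  ∀ x ∈ V, ∀ y ∈ V, ⟪x, T y⟫_ℂ = 0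

theorem Submodule.finrank_le_finrank_inf_ker_add_one {K V : Type*} [Field K] [AddCommGroup V]
    [Module K V] [FiniteDimensional K V] (U : Submodule K V) (f : V →ₗ[K] K) :
    Module.finrank K U ≤ Module.finrank K ↥(U ⊓ LinearMap.ker f) + 1 := by
  have h := Submodule.finrank_sup_add_finrank_inf_eq U (LinearMap.ker f)
  have h1 := LinearMap.finrank_range_add_finrank_ker f
  have h2 : Module.finrank K (LinearMap.range f) ≤ 1 :=
    (Submodule.finrank_le _).trans (by simp)
  have h3 := Submodule.finrank_le (U ⊔ LinearMap.ker f)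
  omega

variable [FiniteDimensional ℂ E]

/-- In the Hermitian form of `S = c T + c̄ T*`, `x` is isotropic and orthogonal to `N` but not to
`u`. As on a hyperbolic plane, adding a multiple of `x` to the part of `u` orthogonal to `N` makes
its value as negative as desired; the new vector enlarges `N`. -/
theorem exists_isNegDefOn_finrank_succ {T : E →ₗ[ℂ] E} {c : ℂ} {U N : Submodule ℂ E} (hNU : N ≤ U)
    (hN : IsNegDefOn T c N) {x u : E} (hx : x ∈ U) (hxx : ⟪x, T x⟫_ℂ = 0)
    (hNx : ∀ y ∈ N, ⟪y, T x⟫_ℂ = 0 ∧ ⟪T y, x⟫_ℂ = 0) (hu : u ∈ U)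
    (hB : c * ⟪x, T u⟫_ℂ + star c * ⟪T x, u⟫_ℂ ≠ 0) :
    ∃ N' ≤ U, IsNegDefOn T c N' ∧ Module.finrank ℂ N' = Module.finrank ℂ N + 1 := by
  set S : E →ₗ[ℂ] E := c • T + star c • LinearMap.adjoint T with hS
  have hSa : ∀ y z, ⟪y, S z⟫_ℂ = c * ⟪y, T z⟫_ℂ + star c * ⟪T y, z⟫_ℂ := by
    intro y z
    simp [hS, LinearMap.adjoint_inner_right]
  have hSs : ∀ y z, ⟪y, S z⟫_ℂ = star ⟪z, S y⟫_ℂ := by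
    intro y z
    simp only [hSa, star_add, star_mul', star_star]
    simp only [Complex.star_def, inner_conj_symm]
    ring
  have hSre : ∀ y, (⟪y, S y⟫_ℂ).re = 2 * (c * ⟪y, T y⟫_ℂ).re := by
    intro y
    rw [hSa, ← inner_conj_symm (T y) y, Complex.star_def, ← map_mul, Complex.add_re,
      Complex.conj_re]
    ring
  have hSN : ∀ y ∈ N, y ≠ 0 → (⟪y, S y⟫_ℂ).re < 0 := fun y hy h0 => by
    rw [hSre]; linarith [hN y hy h0]
  -- the component of `u` that is orthogonal to `N` with respect to `S`
  obtain ⟨y₀, hy₀N, hy₀⟩ : ∃ y₀ ∈ N, ∀ y ∈ N, ⟪y, S y₀⟫_ℂ = ⟪y, S u⟫_ℂ := by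
    set f : N →ₗ[ℂ] N := N.orthogonalProjectionOnto.toLinearMap ∘ₗ S ∘ₗ N.subtype with hf
    have hfi : ∀ (y : N) (v : E), ⟪y, N.orthogonalProjectionOnto v⟫_ℂ = ⟪(y : E), v⟫_ℂ := by
      intro y v
      exact Submodule.inner_orthogonalProjectionOnto_eq_of_mem_left _ _
    have hinj : Function.Injective f := by
      rw [← LinearMap.ker_eq_bot, LinearMap.ker_eq_bot']
      intro y hy
      by_contra h0
      have h1 := hSN y y.2 (by simpa using h0)
      rw [← hfi y (S y), show N.orthogonalProjectionOnto (S y) = f y from rfl, hy] at h1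
      simp at h1
    obtain ⟨y₀, hy₀⟩ := LinearMap.injective_iff_surjective.1 hinj (N.orthogonalProjectionOnto (S u))
    refine ⟨y₀, y₀.2, fun y hy => ?_⟩
    have h1 := hfi ⟨y, hy⟩ (S y₀)
    rw [show N.orthogonalProjectionOnto (S y₀) = f y₀ from rfl, hy₀, hfi] at h1
    exact h1.symm
  set v := u - y₀ with hv
  have hNv : ∀ y ∈ N, ⟪y, S v⟫_ℂ = 0 := fun y hy => by
    rw [hv, map_sub, inner_sub_right, hy₀ y hy, sub_self]
  have hNxS : ∀ y ∈ N, ⟪y, S x⟫_ℂ = 0 := fun y hy => by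
    rw [hSa, (hNx y hy).1, (hNx y hy).2]; simp
  have hxv : ⟪x, S v⟫_ℂ ≠ 0 := by
    rw [hv, map_sub, inner_sub_right, hSs x y₀, hNxS y₀ hy₀N, star_zero, sub_zero, hSa]
    exact hB
  have hxxS : ⟪x, S x⟫_ℂ = 0 := by
    rw [hSa, ← inner_conj_symm (T x) x, hxx]; simp
  set β := ⟪x, S v⟫_ℂ with hβ
  obtain ⟨s, hs⟩ : ∃ s : ℝ, (⟪v, S v⟫_ℂ).re - 2 * s * Complex.normSq β < 0 := by
    have := Complex.normSq_pos.2 hxv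
    refine ⟨((⟪v, S v⟫_ℂ).re + 1) / (2 * Complex.normSq β), ?_⟩
    field_simp
    linarith
  set z := v - ((s : ℂ) * β) • x with hz
  have hNz : ∀ y ∈ N, ⟪y, S z⟫_ℂ = 0 := fun y hy => by
    rw [hz, map_sub, map_smul, inner_sub_right, inner_smul_right, hNv y hy, hNxS y hy]; simp
  have hzz : (⟪z, S z⟫_ℂ).re < 0 := by
    have : ⟪z, S z⟫_ℂ = ⟪v, S v⟫_ℂ - 2 * s * Complex.normSq β := by
      rw [hz]
      simp only [map_sub, map_smul, inner_sub_left, inner_sub_right, inner_smul_left,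
        inner_smul_right, hxxS, hSs v x, ← hβ]
      rw [Complex.normSq_eq_conj_mul_self]
      simp
      ring
    rw [this]
    simpa using hs
  have hzN : z ∉ N := fun h => by
    rw [hNz z h] at hzz
    simp at hzz
  have hzU : z ∈ U := U.sub_mem (U.sub_mem hu (hNU hy₀N)) (U.smul_mem _ hx)
  refine ⟨N ⊔ Submodule.span ℂ {z}, sup_le hNU (by simpa using hzU), ?_,
    Submodule.finrank_sup_span_singleton hzN⟩
  intro w hw hw0
  obtain ⟨y, hy, z', hz', rfl⟩ := Submodule.mem_sup.1 hw
  obtain ⟨ζ, rfl⟩ := Submodule.mem_span_singleton.1 hz'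
  have h1 : (⟪y + ζ • z, S (y + ζ • z)⟫_ℂ).re =
      (⟪y, S y⟫_ℂ).re + Complex.normSq ζ * (⟪z, S z⟫_ℂ).re := by
    simp only [map_add, map_smul, inner_add_left, inner_add_right, inner_smul_left,
        inner_smul_right, hNz y hy, hSs z y]
    rw [star_zero, mul_zero, add_zero, zero_add, ← mul_assoc, Complex.mul_conj, Complex.add_re,
      Complex.re_ofReal_mul]
  have h2 : (⟪y + ζ • z, S (y + ζ • z)⟫_ℂ).re < 0 := by
    rw [h1]
    rcases eq_or_ne ζ 0 with rfl | hζ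
    · have : y ≠ 0 := by simpa using hw0
      simpa using hSN y hy this
    · have h3 : Complex.normSq ζ * (⟪z, S z⟫_ℂ).re < 0 :=
        mul_neg_of_pos_of_neg (Complex.normSq_pos.2 hζ) hzz
      rcases eq_or_ne y 0 with rfl | hy0
      · simpa using h3
      · linarith [hSN y hy hy0]
  rw [hSre] at h2
  linarith

/-- Definiteness needs checking only on the unit sphere of `N`, which is compact, so it is an open
condition on `c`. -/
theorem IsNegDefOn.exists_pos_forall_norm_sub_lt {T : E →ₗ[ℂ] E} {c : ℂ} {N : Submodule ℂ E}
    (hN : IsNegDefOn T c N) : ∃ η > 0, ∀ c' : ℂ, ‖c' - c‖ < η → IsNegDefOn T c' N := by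
  have hT : Continuous T := T.continuous_of_finiteDimensional
  have hK : IsCompact (Metric.sphere (0 : E) 1 ∩ N) :=
    (isCompact_sphere 0 1).inter_right N.closed_of_finiteDimensional
  have hopen : IsOpen {c' : ℂ | ∀ x ∈ Metric.sphere (0 : E) 1 ∩ N, (c' * ⟪x, T x⟫_ℂ).re < 0} := by
    rw [← isClosed_compl_iff]
    convert isClosed_setOf_exists_mem_isCompact hK
      (s := {q : ℂ × E | 0 ≤ (q.1 * ⟪q.2, T q.2⟫_ℂ).re})
      (isClosed_le continuous_const (by fun_prop)) using 1
    ext c'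
    simp [and_assoc]
  have hc : c ∈ {c' : ℂ | ∀ x ∈ Metric.sphere (0 : E) 1 ∩ N, (c' * ⟪x, T x⟫_ℂ).re < 0} := by
    rintro x ⟨hx1, hxN⟩
    exact hN x hxN (by rintro rfl; simp at hx1)
  obtain ⟨η, hη, hball⟩ := Metric.isOpen_iff.1 hopen c hc
  refine ⟨η, hη, fun c' hc' x hx hx0 => ?_⟩
  have hn : ‖x‖ ≠ 0 := by simpa using hx0
  have h1 := hball (by simpa [dist_eq_norm] using hc') (((‖x‖⁻¹ : ℝ) : ℂ) • x)
    ⟨by simp [norm_smul, hn], N.smul_mem _ hx⟩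
  rw [map_smul, inner_smul_left, inner_smul_right, Complex.conj_ofReal] at h1
  have h2 : c' * (((‖x‖⁻¹ : ℝ) : ℂ) * (((‖x‖⁻¹ : ℝ) : ℂ) * ⟪x, T x⟫_ℂ)) =
      ((‖x‖⁻¹ * ‖x‖⁻¹ : ℝ) : ℂ) * (c' * ⟪x, T x⟫_ℂ) := by push_cast; ring
  rw [h2, Complex.re_ofReal_mul] at h1
  exact (pos_iff_neg_of_mul_neg h1).1 (by positivity)

/-- An isotropic vector at which the two functionals of the form are linearly dependent on `U` can
be split off. -/
theorem NegDefBound.exists_lt_of_isotropic {T : E →ₗ[ℂ] E} {U : Submodule ℂ E} {k : ℕ}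
    (h : NegDefBound T U (k + 1)) {x : E} (hx : x ∈ U) (hx0 : x ≠ 0) (hxx : ⟪x, T x⟫_ℂ = 0)
    {α β : ℂ} (hαβ : α ≠ 0 ∨ β ≠ 0) (hdep : ∀ y ∈ U, α * ⟪T x, y⟫_ℂ = β * ⟪x, T y⟫_ℂ) :
    ∃ U' ≤ U, x ∉ U' ∧ (∀ y ∈ U', ⟪T x, y⟫_ℂ = 0 ∧ ⟪x, T y⟫_ℂ = 0) ∧ NegDefBound T U' k := by
  set f₀ : E →ₗ[ℂ] ℂ := (innerSL ℂ x).toLinearMap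
  set f₁ : E →ₗ[ℂ] ℂ := (innerSL ℂ (T x)).toLinearMap
  set f₂ : E →ₗ[ℂ] ℂ := (innerSL ℂ x).toLinearMap ∘ₗ T
  -- By the linear dependence, one functional suffices to cut out the common kernel of both.
  have key : ∃ f : E →ₗ[ℂ] ℂ, ∀ y ∈ U, f y = 0 → ⟪T x, y⟫_ℂ = 0 ∧ ⟪x, T y⟫_ℂ = 0 := by
    rcases hαβ with hα | hβ
    · refine ⟨f₂, fun y hy hy0 => ?_⟩
      have h0 : ⟪x, T y⟫_ℂ = 0 := hy0
      exact ⟨by simpa [h0, hα] using hdep y hy, h0⟩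
    · refine ⟨f₁, fun y hy hy0 => ?_⟩
      have h0 : ⟪T x, y⟫_ℂ = 0 := hy0
      exact ⟨h0, by simpa [h0, hβ] using hdep y hy⟩
  -- When `x` is not in the radical, `N` can be enlarged by one dimension. Together with the bound
  -- for `k + 1` this gives `k + 2`, which pays for the two hyperplanes that cut out `U'`.
  have hneg : ∀ c : ℂ, ∀ N ≤ U, (∀ y ∈ N, ⟪T x, y⟫_ℂ = 0 ∧ ⟪x, T y⟫_ℂ = 0) → IsNegDefOn T c N →
      (∃ u ∈ U, ⟪T x, u⟫_ℂ ≠ 0 ∨ ⟪x, T u⟫_ℂ ≠ 0) →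
      Module.finrank ℂ N + k + 2 ≤ Module.finrank ℂ U := by
    intro c N hNU hNx hN ⟨u, hu, hu0⟩
    obtain ⟨η, hη, hN'⟩ := hN.exists_pos_forall_norm_sub_lt
    -- The pairing of `x` with `u` may vanish for `c` itself. It is real-linear in `c`, so vanishing
    -- at `c`, `c + η / 2` and `c + (η / 2) I` would force both inner products to be zero.
    obtain ⟨c', hc', hB⟩ : ∃ c' : ℂ, ‖c' - c‖ < η ∧
        c' * ⟪x, T u⟫_ℂ + star c' * ⟪T x, u⟫_ℂ ≠ 0 := by
      by_contra! hcon
      have e0 := hcon c (by simpa using hη)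
      have hη2 : |η| / 2 < η := by rw [abs_of_pos hη]; linarith
      have e1 := hcon (c + (η / 2 : ℝ)) (by simpa using hη2)
      have e2 := hcon (c + (η / 2 : ℝ) * Complex.I) (by simpa using hη2)
      have hη0 : ((η / 2 : ℝ) : ℂ) ≠ 0 := by
        exact_mod_cast (half_pos hη).ne'
      simp only [star_add, star_mul', Complex.star_def, Complex.conj_ofReal, Complex.conj_I]
        at e0 e1 e2
      have e3 : ⟪x, T u⟫_ℂ + ⟪T x, u⟫_ℂ = 0 := by
        apply mul_left_cancel₀ hη0
        linear_combination e1 - e0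
      have e4 : ⟪x, T u⟫_ℂ - ⟪T x, u⟫_ℂ = 0 := by
        apply mul_left_cancel₀ (mul_ne_zero hη0 Complex.I_ne_zero)
        linear_combination e2 - e0
      have e5 : ⟪x, T u⟫_ℂ = 0 := by linear_combination (e3 + e4) / 2
      have e6 : ⟪T x, u⟫_ℂ = 0 := by linear_combination (e3 - e4) / 2
      exact hu0.elim (fun h => h e6) (fun h => h e5)
    obtain ⟨N₁, hN₁U, hN₁, hr⟩ := exists_isNegDefOn_finrank_succ hNU (hN' c' hc') hx hxx
      (fun y hy => by
        obtain ⟨h1, h2⟩ := hNx y hy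
        rw [← inner_conj_symm, h1, ← inner_conj_symm (T y), h2]
        simp) hu hB
    have := h c' N₁ hN₁U hN₁
    omega
  have hxmem : ∀ V : Submodule ℂ E, x ∉ V ⊓ LinearMap.ker f₀ := fun V hxV => by
    have : ⟪x, x⟫_ℂ = 0 := hxV.2
    exact hx0 (inner_self_eq_zero.1 this)
  by_cases hz : ∃ u ∈ U, ⟪T x, u⟫_ℂ ≠ 0 ∨ ⟪x, T u⟫_ℂ ≠ 0
  · obtain ⟨f, hf⟩ := key
    refine ⟨U ⊓ LinearMap.ker f ⊓ LinearMap.ker f₀, inf_le_left.trans inf_le_left, hxmem _,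
      fun y hy => hf y hy.1.1 hy.1.2, fun c N hN hneg' => ?_⟩
    have h1 := U.finrank_le_finrank_inf_ker_add_one f
    have h2 := (U ⊓ LinearMap.ker f).finrank_le_finrank_inf_ker_add_one f₀
    have h3 := hneg c N (fun y hy => (hN hy).1.1) (fun y hy => hf y (hN hy).1.1 (hN hy).1.2)
      hneg' hz
    omega
  · push Not at hz
    -- Here `x` lies in the radical of the form on `U`, and the single hyperplane orthogonal to `x`
    -- suffices.
    refine ⟨U ⊓ LinearMap.ker f₀, inf_le_left, hxmem _, fun y hy => hz y hy.1,
      fun c N hN hneg' => ?_⟩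
    have h2 := U.finrank_le_finrank_inf_ker_add_one f₀
    have h3 := h c N (fun y hy => (hN hy).1) hneg'
    omega

/-- For the compression `A` of `T` to `U`, this is an eigenvector problem for the pencil of `A` and
its adjoint: an eigenvector of `A⁻¹ A*` if `A` is invertible, a kernel vector of `A` otherwise. -/
theorem exists_dependent_functionals (T : E →ₗ[ℂ] E) {U : Submodule ℂ E} (hU : U ≠ ⊥) :
    ∃ x ∈ U, x ≠ 0 ∧ ∃ α β : ℂ, (α ≠ 0 ∨ β ≠ 0) ∧
      ∀ y ∈ U, α * ⟪T x, y⟫_ℂ = β * ⟪x, T y⟫_ℂ := by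
  set A : U →ₗ[ℂ] U := U.orthogonalProjectionOnto.toLinearMap ∘ₗ T ∘ₗ U.subtype with hA
  have hAi : ∀ x y : U, ⟪A x, y⟫_ℂ = ⟪T x, (y : E)⟫_ℂ := by
    intro x y
    rw [Submodule.coe_inner]
    exact Submodule.inner_orthogonalProjectionOnto_eq_of_mem_right _ _
  have hAi' : ∀ x y : U, ⟪LinearMap.adjoint A x, y⟫_ℂ = ⟪(x : E), T y⟫_ℂ := by
    intro x y
    rw [LinearMap.adjoint_inner_left, ← inner_conj_symm, hAi, inner_conj_symm]
  suffices h : ∃ x : U, x ≠ 0 ∧ ∃ α β : ℂ, (α ≠ 0 ∨ β ≠ 0) ∧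
      α • A x = β • LinearMap.adjoint A x by
    obtain ⟨x, hx0, α, β, hαβ, hx⟩ := h
    refine ⟨x, x.2, by simpa using hx0, star α, star β, by simpa using hαβ, fun y hy => ?_⟩
    have := congrArg (fun v => ⟪v, (⟨y, hy⟩ : U)⟫_ℂ) hx
    simpa only [inner_smul_left, hAi, hAi', Complex.star_def] using this
  have : Nontrivial U := Submodule.nontrivial_iff_ne_bot.2 hU
  by_cases hinj : Function.Injective A
  · obtain ⟨μ, hμ⟩ := Module.End.exists_eigenvalue
      ((LinearEquiv.ofInjectiveEndo A hinj).symm.toLinearMap ∘ₗ LinearMap.adjoint A)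
    obtain ⟨x, hx⟩ := hμ.exists_hasEigenvector
    refine ⟨x, hx.2, μ, 1, by simp, ?_⟩
    have h1 := congrArg (LinearEquiv.ofInjectiveEndo A hinj) hx.apply_eq_smul
    rw [map_smul] at h1
    simpa using h1.symm
  · rw [← LinearMap.ker_eq_bot, LinearMap.ker_eq_bot'] at hinj
    push Not at hinj
    obtain ⟨x, hx, hx0⟩ := hinj
    exact ⟨x, hx0, 1, 0, by simp, by simp [hx]⟩

end SesquilinearForm

/-! ### Totally isotropic subspaces of diagonal forms -/

theorem exists_sum_equiv_monotone {ι : Type*} [Fintype ι] (s : ι → Prop) (t : ι → ℝ) :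
    ∃ (p q : ℕ) (e : Fin p ⊕ Fin q ≃ ι), (∀ i, s (e (Sum.inl i))) ∧ (∀ j, ¬ s (e (Sum.inr j))) ∧
      Monotone (fun i => t (e (Sum.inl i))) ∧ Monotone (fun j => t (e (Sum.inr j))) := by
  classical
  have key : ∀ (κ : Type _) [Fintype κ] (f : κ → ℝ), ∃ e : Fin (Fintype.card κ) ≃ κ,
      Monotone (fun i => f (e i)) := fun κ _ f =>
    ⟨(Tuple.sort (f ∘ (Fintype.equivFin κ).symm)).trans (Fintype.equivFin κ).symm,
      Tuple.monotone_sort (f ∘ (Fintype.equivFin κ).symm)⟩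
  obtain ⟨e₁, h₁⟩ := key {i // s i} (fun i => t i)
  obtain ⟨e₂, h₂⟩ := key {i // ¬ s i} (fun i => t i)
  refine ⟨_, _, (e₁.sumCongr e₂).trans (Equiv.sumCompl s), fun i => ?_, fun j => ?_, h₁, h₂⟩
  · simpa using (e₁ i).2
  · simpa using (e₂ j).2

theorem dense_setOf_mul_re_ne_zero {d : ℂ} (hd : d ≠ 0) : Dense {c : ℂ | (c * d).re ≠ 0} := by
  intro c
  rw [Metric.mem_closure_iff]
  intro η hη
  have hn : 0 < ‖d‖ := norm_pos_iff.2 hd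
  by_cases h : (c * d).re = 0
  · refine ⟨c + ((η / (2 * ‖d‖) : ℝ) : ℂ) * star d, ?_, ?_⟩
    · simp only [Set.mem_ofPred_eq, add_mul, Complex.add_re, h, zero_add, mul_assoc,
        Complex.star_def, Complex.conj_mul', Complex.re_ofReal_mul]
      norm_cast
      positivity
    · rw [dist_eq_norm, norm_sub_rev, add_sub_cancel_left, norm_mul, norm_star, Complex.norm_real,
        Real.norm_of_nonneg (by positivity)]
      field_simp
      norm_num
  · exact ⟨c, h, by simpa using hη⟩

/-- The count takes finitely many values, so it has a maximizer. Negative real parts stay negative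
nearby, and the `c` for which no real part vanishes are dense, so the maximizer can be moved to a
generic one. -/
theorem exists_generic_maximal_negative_count {ι : Type*} [Fintype ι] {d : ι → ℂ}
    (hd : ∀ i, d i ≠ 0) : ∃ c₀ : ℂ, (∀ i, (c₀ * d i).re ≠ 0) ∧
      ∀ c : ℂ, (Finset.univ.filter fun i => (c * d i).re < 0).card ≤
        (Finset.univ.filter fun i => (c₀ * d i).re < 0).card := by
  classical
  obtain ⟨c₁, hc₁⟩ : ∃ c₁ : ℂ, ∀ c : ℂ, (Finset.univ.filter fun i => (c * d i).re < 0).card ≤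
        (Finset.univ.filter fun i => (c₁ * d i).re < 0).card := by
    set f : ℂ → ℕ := fun c => (Finset.univ.filter fun i => (c * d i).re < 0).card
    have hb : BddAbove (Set.range f) :=
      ⟨Fintype.card ι, by rintro _ ⟨c, rfl⟩; exact Finset.card_le_univ _⟩
    obtain ⟨c₁, hc₁⟩ := Nat.sSup_mem (Set.range_nonempty f) hb
    exact ⟨c₁, fun c => (le_csSup hb ⟨c, rfl⟩).trans hc₁.ge⟩
  have hdense : Dense (⋂ i, {c : ℂ | (c * d i).re ≠ 0}) :=
    dense_iInter_of_isOpen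
      (fun i => isOpen_ne_fun (by fun_prop) continuous_const)
      fun i => dense_setOf_mul_re_ne_zero (hd i)
  have hopen : IsOpen (⋂ i, {c : ℂ | (c₁ * d i).re < 0 → (c * d i).re < 0}) := by
    refine isOpen_iInter_of_finite fun i => ?_
    by_cases h : (c₁ * d i).re < 0
    · simp only [h, forall_const]
      exact isOpen_lt (by fun_prop) continuous_const
    · simp only [h, false_imp_iff]
      exact isOpen_const
  obtain ⟨c₀, h₁, h₂⟩ := hdense.inter_open_nonempty _ hopen
    ⟨c₁, by simp only [Set.mem_iInter, Set.mem_ofPred_eq]; exact fun _ h => h⟩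
  simp only [Set.mem_iInter, Set.mem_ofPred_eq] at h₁ h₂
  exact ⟨c₀, h₂, fun c => (hc₁ c).trans (Finset.card_le_card
    (Finset.monotone_filter_right _ fun i _ h => h₁ i h))⟩

/-- A complex diagonal form, every rotation of which has at most `n - k` negative entries in the
real part, has a totally isotropic subspace of dimension `k`. -/
theorem exists_isotropic_matrix_of_diagonal {ι : Type*} [Fintype ι] [DecidableEq ι] {k : ℕ}
    {d : ι → ℂ} (hd : ∀ i, d i ≠ 0)
    (h : ∀ c : ℂ, (Finset.univ.filter fun i => (c * d i).re < 0).card + k ≤ Fintype.card ι) :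
    ∃ W : Matrix ι (Fin k) ℂ, Wᴴ * Matrix.diagonal d * W = 0 ∧ ∀ v, W *ᵥ v = 0 → v = 0 := by
  obtain ⟨c₀, hc₀, hmax⟩ := exists_generic_maximal_negative_count hd
  -- The rotated entries are `η i (1 + t i I)`. Further rotation compares the slopes `t i` with a
  -- threshold `τ`, in opposite senses for the two signs of `η i`.
  set η : ι → ℝ := fun i => (c₀ * d i).re with hη
  set t : ι → ℝ := fun i => (c₀ * d i).im / η i with ht
  have hdt : ∀ i, c₀ * d i = η i * (1 + t i * Complex.I) := by
    intro i
    have h1 : ((c₀ * d i).im : ℂ) = η i * t i := by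
      rw [← Complex.ofReal_mul, ht, mul_div_cancel₀ _ (hc₀ i)]
    conv_lhs => rw [← Complex.re_add_im (c₀ * d i), h1]
    ring
  have hrot : ∀ (τ : ℝ) i, ((-τ - Complex.I) * c₀ * d i).re = η i * (t i - τ) := by
    intro τ i
    rw [mul_assoc, hdt]
    simp
    ring
  have hrot' : ∀ (τ : ℝ) i, ((τ + Complex.I) * c₀ * d i).re = η i * (τ - t i) := by
    intro τ i
    rw [mul_assoc, hdt]
    simp
    ring
  obtain ⟨p, q, e, hpos, hneg, hmp, hmq⟩ := exists_sum_equiv_monotone (fun i => 0 < η i) t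
  replace hneg : ∀ j, η (e (Sum.inr j)) < 0 := fun j =>
    lt_of_le_of_ne (not_lt.1 (hneg j)) (hc₀ _)
  have hlow : ∀ (c : ℂ) (A : Finset (Fin p)) (B : Finset (Fin q)),
      (∀ i ∈ A, (c * d (e (Sum.inl i))).re < 0) → (∀ j ∈ B, (c * d (e (Sum.inr j))).re < 0) →
      A.card + B.card ≤ (Finset.univ.filter fun i => (c * d i).re < 0).card := by
    intro c A B hA hB
    rw [← Finset.card_disjSum, ← Finset.card_map e.toEmbedding]
    refine Finset.card_le_card fun x hx => ?_
    obtain ⟨y, hy, rfl⟩ := Finset.mem_map.1 hx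
    rw [Finset.mem_filter]
    refine ⟨Finset.mem_univ _, ?_⟩
    rcases Finset.mem_disjSum.1 hy with ⟨i, hi, rfl⟩ | ⟨j, hj, rfl⟩
    · exact hA i hi
    · exact hB j hj
  have hq : (Finset.univ.filter fun i => (c₀ * d i).re < 0).card = q := by
    refine le_antisymm ?_ ?_
    · rw [← Fintype.card_fin q, ← Finset.card_univ (α := Fin q),
        ← Finset.card_map (Function.Embedding.inr.trans e.toEmbedding)]
      refine Finset.card_le_card fun x hx => ?_
      obtain ⟨y, rfl⟩ := e.surjective x
      rcases y with i | j
      · exact absurd (hpos i) (not_lt.2 (Finset.mem_filter.1 hx).2.le)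
      · exact Finset.mem_map.2 ⟨j, Finset.mem_univ _, rfl⟩
    · simpa using hlow c₀ ∅ Finset.univ (by simp) (fun j _ => hneg j)
  rw [hq] at hmax
  have hcard : p + q = Fintype.card ι := by simpa using Fintype.card_congr e
  have hkp : k ≤ p := by
    have := h c₀
    omega
  obtain ⟨r, rfl⟩ : ∃ r, q = p + r := by
    refine Nat.exists_eq_add_of_le ?_
    have := hlow (-c₀) Finset.univ ∅ (fun i _ => by
      have := hpos i
      simp only [neg_mul, Complex.neg_re, hη] at this ⊢
      linarith) (by simp)
    simpa using this.trans (hmax _)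
  set b : ℕ → ℝ := fun i => if hi : i < p then t (e (Sum.inl ⟨i, hi⟩)) else 0 with hb
  set a : ℕ → ℝ := fun j => if hj : j < p + r then t (e (Sum.inr ⟨j, hj⟩)) else 0 with ha
  have hb' : ∀ i : Fin p, b i = t (e (Sum.inl i)) := fun i => by simp [hb]
  have ha' : ∀ j : Fin (p + r), a j = t (e (Sum.inr j)) := fun j => by simp [ha]
  have hbm : ∀ i j, i ≤ j → j < p → b i ≤ b j := by
    intro i j hij hj
    rw [hb' ⟨i, by omega⟩, hb' ⟨j, hj⟩]
    exact hmp (by simpa using hij)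
  have ham : ∀ i j, i ≤ j → j < p + r → a i ≤ a j := by
    intro i j hij hj
    rw [ha' ⟨i, by omega⟩, ha' ⟨j, hj⟩]
    exact hmq (by simpa using hij)
  -- If an interlacing inequality fails, a `τ` in the gap defines a rotation with at least `p + r +
  -- 1` negative entries, against the maximal count `p + r`.
  obtain ⟨T, hT, hT'⟩ := exists_compression_of_interlacing_add p r a b
    (fun i hi => ham _ _ (Nat.le_succ i) hi) hbm
    (by
      intro i hi
      by_contra! hlt
      obtain ⟨τ, h1, h2⟩ := exists_between hlt
      have := (hlow ((-τ - Complex.I) * c₀) (Finset.Iic ⟨i, hi⟩) (Finset.Ici ⟨i, by omega⟩)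
        (fun l hl => by
          rw [hrot, ← hb']
          have := hbm l i (Fin.le_def.1 (Finset.mem_Iic.1 hl)) hi
          exact mul_neg_of_pos_of_neg (hpos l) (by linarith))
        (fun l hl => by
          rw [hrot, ← ha']
          have := ham i l (Fin.le_def.1 (Finset.mem_Ici.1 hl)) l.2
          exact mul_neg_of_neg_of_pos (hneg l) (by linarith))).trans (hmax _)
      simp only [Fin.card_Iic, Fin.card_Ici] at this
      omega)
    (by
      intro i hi
      by_contra! hlt
      obtain ⟨τ, h1, h2⟩ := exists_between hlt
      have := (hlow ((τ + Complex.I) * c₀) (Finset.Ici ⟨i, hi⟩) (Finset.Iic ⟨i + r, by omega⟩)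
        (fun l hl => by
          rw [hrot', ← hb']
          have := hbm i l (Fin.le_def.1 (Finset.mem_Ici.1 hl)) l.2
          exact mul_neg_of_pos_of_neg (hpos l) (by linarith))
        (fun l hl => by
          rw [hrot', ← ha']
          have := ham l (i + r) (Fin.le_def.1 (Finset.mem_Iic.1 hl)) (by omega)
          exact mul_neg_of_neg_of_pos (hneg l) (by linarith))).trans (hmax _)
      simp only [Fin.card_Iic, Fin.card_Ici] at this
      omega)
  set g : Fin k → Fin p := Fin.castLE hkp with hg
  have hgi : Function.Injective g := Fin.castLE_injective hkp
  -- After scaling by `√|η|`, column `l` is the graph of `T` over the basis vector `g l`. The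
  -- positive entries contribute `I_k + i diag(b)`, restricted to the first `k` indices, and the
  -- negative ones cancel this through `Tᵀ T = 1` and `Tᵀ diag(a) T = diag(b)`.
  set w : Fin p ⊕ Fin (p + r) → Fin k → ℝ := fun x l =>
    Sum.elim (fun i => if i = g l then (√(η (e (Sum.inl i))))⁻¹ else 0)
      (fun j => T j (g l) * (√(-η (e (Sum.inr j))))⁻¹) x with hw
  refine ⟨Matrix.of fun i l => (w (e.symm i) l : ℂ), ?_, ?_⟩
  · suffices hs : ∀ l m : Fin k, ∑ x, (w x l : ℂ) * (c₀ * d (e x)) * w x m = 0 by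
      ext l m
      have hc0 : c₀ ≠ 0 := fun h0 => hc₀ (e (Sum.inl (g l))) (by simp [h0])
      have h1 := hs l m
      rw [← Equiv.sum_comp e.symm] at h1
      simp only [Equiv.apply_symm_apply] at h1
      rw [Matrix.mul_apply]
      simp only [Matrix.mul_diagonal, Matrix.conjTranspose_apply, Matrix.of_apply,
        Complex.star_def, Complex.conj_ofReal, Matrix.zero_apply]
      apply mul_left_cancel₀ hc0
      rw [mul_zero, ← h1, Finset.mul_sum]
      exact Finset.sum_congr rfl fun _ _ => by ring
    intro l m
    have hpp : ∀ i, (w (Sum.inl i) l : ℂ) * (c₀ * d (e (Sum.inl i))) * w (Sum.inl i) m =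
        if i = g l then (if l = m then 1 + (b i : ℂ) * Complex.I else 0) else 0 := by
      intro i
      rw [hdt, hb']
      by_cases h1 : i = g l
      · by_cases h2 : l = m
        · subst h2
          simp only [hw, h1, Sum.elim_inl, if_true]
          have h3 : (√(η (e (Sum.inl (g l)))) : ℂ) * √(η (e (Sum.inl (g l)))) =
              (η (e (Sum.inl (g l))) : ℂ) := by
            exact_mod_cast Real.mul_self_sqrt (hpos (g l)).le
          have h4 : (√(η (e (Sum.inl (g l)))) : ℂ) ≠ 0 := by
            exact_mod_cast (Real.sqrt_pos.2 (hpos (g l))).ne'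
          rw [← h3]
          push_cast
          field_simp
        · simp [hw, h1, h2, hgi.eq_iff]
      · simp [hw, h1]
    have hqq : ∀ j, (w (Sum.inr j) l : ℂ) * (c₀ * d (e (Sum.inr j))) * w (Sum.inr j) m =
        -((T j (g l) * T j (g m) : ℝ) : ℂ) -
          ((T j (g l) * a j * T j (g m) : ℝ) : ℂ) * Complex.I := by
      intro j
      rw [hdt, ha']
      simp only [hw, Sum.elim_inr]
      have h3 : (√(-η (e (Sum.inr j))) : ℂ) * √(-η (e (Sum.inr j))) =
          -(η (e (Sum.inr j)) : ℂ) := by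
        exact_mod_cast Real.mul_self_sqrt (neg_pos.2 (hneg j)).le
      have h4 : (√(-η (e (Sum.inr j))) : ℂ) ≠ 0 := by
        exact_mod_cast (Real.sqrt_pos.2 (neg_pos.2 (hneg j))).ne'
      rw [← neg_eq_iff_eq_neg.2 h3]
      push_cast
      field_simp
      ring
    have e1 := congrFun (congrFun hT (g l)) (g m)
    have e2 := congrFun (congrFun hT' (g l)) (g m)
    rw [Matrix.mul_apply] at e1 e2
    simp only [Matrix.mul_diagonal, Matrix.transpose_apply, Matrix.one_apply,
      Matrix.diagonal_apply, hgi.eq_iff] at e1 e2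
    rw [Fintype.sum_sum_type]
    simp only [hpp, hqq]
    rw [Finset.sum_sub_distrib, Finset.sum_neg_distrib, ← Finset.sum_mul, ← Complex.ofReal_sum,
      ← Complex.ofReal_sum, e1, e2]
    by_cases h2 : l = m
    · simp [h2]
    · simp [h2]
  · intro v hv
    ext l
    have h1 := congrFun hv (e (Sum.inl (g l)))
    simp only [Matrix.mulVec, dotProduct, Matrix.of_apply, Equiv.symm_apply_apply, hw,
      Sum.elim_inl, hgi.eq_iff] at h1
    simpa [(hpos (g l)).not_ge, Real.sqrt_eq_zero', apply_ite, ite_mul] using h1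

/-! ### Totally isotropic subspaces of general forms -/

section TotallyIsotropic

variable {E : Type*} [NormedAddCommGroup E] [InnerProductSpace ℂ E]

theorem inner_sum_smul_map_sum_smul {T : E →ₗ[ℂ] E} {ι : Type*} [Fintype ι] {b : ι → E}
    (hb : ∀ i j, i ≠ j → ⟪b i, T (b j)⟫_ℂ = 0) (x y : ι → ℂ) :
    ⟪∑ i, x i • b i, T (∑ i, y i • b i)⟫_ℂ = ∑ i, star (x i) * ⟪b i, T (b i)⟫_ℂ * y i := by
  simp only [map_sum, map_smul, sum_inner, inner_sum, inner_smul_left, inner_smul_right]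
  refine Finset.sum_congr rfl fun i _ => ?_
  rw [Finset.sum_eq_single i]
  · simp only [Complex.star_def]
    ring
  · intro j _ hji
    rw [hb j i hji]
    simp
  · simp

theorem linearIndependent_of_inner_map {T : E →ₗ[ℂ] E} {ι : Type*} [Fintype ι] {b : ι → E}
    (hb : ∀ i j, i ≠ j → ⟪b i, T (b j)⟫_ℂ = 0) (hb0 : ∀ i, ⟪b i, T (b i)⟫_ℂ ≠ 0) :
    LinearIndependent ℂ b := by
  classical
  rw [Fintype.linearIndependent_iff]
  intro g hg i
  have h := inner_sum_smul_map_sum_smul hb (Pi.single i 1) g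
  rw [hg, map_zero, inner_zero_right] at h
  simpa [Pi.single_apply, apply_ite, ite_mul, hb0 i] using h

/-- The family diagonalizes the form. For each `c`, the `b i` with negative `Re (c ⟪b i, T (b i)⟫)`
span a negative definite subspace, so the bound becomes the counting hypothesis of the diagonal
case. -/
theorem NegDefBound.exists_isotropic_of_orthogonal_family {T : E →ₗ[ℂ] E} {U : Submodule ℂ E}
    {k n : ℕ} (h : NegDefBound T U k) (hn : Module.finrank ℂ U = n) {b : Fin n → E}
    (hbU : ∀ i, b i ∈ U) (hb : ∀ i j, i ≠ j → ⟪b i, T (b j)⟫_ℂ = 0)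
    (hb0 : ∀ i, ⟪b i, T (b i)⟫_ℂ ≠ 0) :
    ∃ V ≤ U, Module.finrank ℂ V = k ∧ IsTotallyIsotropic T V := by
  have hli := linearIndependent_of_inner_map hb hb0
  obtain ⟨W, hW, hWi⟩ := exists_isotropic_matrix_of_diagonal (k := k) hb0 (by
    intro c
    set s := Finset.univ.filter fun i => (c * ⟪b i, T (b i)⟫_ℂ).re < 0 with hs
    have hlis : LinearIndependent ℂ fun i : s => b i := hli.comp _ Subtype.val_injective
    have h1 := h c (LinearMap.range (Fintype.linearCombination ℂ fun i : s => b i)) (by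
      rintro _ ⟨x, rfl⟩
      rw [Fintype.linearCombination_apply]
      exact U.sum_mem fun i _ => U.smul_mem _ (hbU i)) (by
      rintro _ ⟨x, rfl⟩ hx0
      rw [Fintype.linearCombination_apply] at hx0 ⊢
      rw [inner_sum_smul_map_sum_smul (b := fun i : s => b i) (fun i j hij => hb i j fun he => hij (Subtype.ext he)),
        Finset.mul_sum, Complex.re_sum]
      have hterm : ∀ i : s, (c * (star (x i) * ⟪b i, T (b i)⟫_ℂ * x i)).re =
          Complex.normSq (x i) * (c * ⟪b i, T (b i)⟫_ℂ).re := by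
        intro i
        rw [← Complex.re_ofReal_mul, Complex.normSq_eq_conj_mul_self, Complex.star_def]
        congr 1
        ring
      simp only [hterm]
      have hneg : ∀ i : s, (c * ⟪b i, T (b i)⟫_ℂ).re < 0 := fun i => (Finset.mem_filter.1 i.2).2
      refine Finset.sum_neg' (fun i _ => mul_nonpos_of_nonneg_of_nonpos (Complex.normSq_nonneg _)
        (hneg i).le) ?_
      obtain ⟨i, -, hi⟩ := Finset.exists_ne_zero_of_sum_ne_zero hx0
      refine ⟨i, Finset.mem_univ i, mul_neg_of_pos_of_neg (Complex.normSq_pos.2 ?_) (hneg i)⟩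
      rintro h0
      simp [h0] at hi)
    rw [LinearMap.finrank_range_of_inj hlis.fintypeLinearCombination_injective] at h1
    simpa [hn] using h1)
  have hinj : Function.Injective (Fintype.linearCombination ℂ b ∘ₗ W.mulVecLin) := by
    rw [LinearMap.coe_comp]
    refine hli.fintypeLinearCombination_injective.comp ?_
    rw [← LinearMap.ker_eq_bot, LinearMap.ker_eq_bot']
    exact hWi
  refine ⟨LinearMap.range (Fintype.linearCombination ℂ b ∘ₗ W.mulVecLin), ?_, ?_, ?_⟩
  · rintro _ ⟨x, rfl⟩
    rw [LinearMap.comp_apply, Fintype.linearCombination_apply]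
    exact U.sum_mem fun i _ => U.smul_mem _ (hbU i)
  · rw [LinearMap.finrank_range_of_inj hinj]
    simp
  · rintro _ ⟨x, rfl⟩ _ ⟨y, rfl⟩
    rw [LinearMap.comp_apply, Fintype.linearCombination_apply, LinearMap.comp_apply,
      Fintype.linearCombination_apply, inner_sum_smul_map_sum_smul hb]
    have h1 : ∑ i, star (W.mulVecLin x i) * ⟪b i, T (b i)⟫_ℂ * W.mulVecLin y i =
        star x ⬝ᵥ ((Wᴴ * Matrix.diagonal (fun i => ⟪b i, T (b i)⟫_ℂ) * W) *ᵥ y) := by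
      rw [← Matrix.mulVec_mulVec, ← Matrix.mulVec_mulVec, Matrix.dotProduct_mulVec,
        ← Matrix.star_mulVec]
      simp [dotProduct, Matrix.mulVec_diagonal, mul_assoc]
    rw [h1, hW]
    simp

variable [FiniteDimensional ℂ E]

theorem exists_form_orthogonal_family (T : E →ₗ[ℂ] E) (n : ℕ) (U : Submodule ℂ E)
    (hn : Module.finrank ℂ U = n)
    (h : ∀ x ∈ U, x ≠ 0 → ∀ α β : ℂ, (α ≠ 0 ∨ β ≠ 0) →
      (∀ y ∈ U, α * ⟪T x, y⟫_ℂ = β * ⟪x, T y⟫_ℂ) → ⟪x, T x⟫_ℂ ≠ 0) :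
    ∃ b : Fin n → E, (∀ i, b i ∈ U) ∧ (∀ i j, i ≠ j → ⟪b i, T (b j)⟫_ℂ = 0) ∧
      ∀ i, ⟪b i, T (b i)⟫_ℂ ≠ 0 := by
  induction n generalizing U with
  | zero => exact ⟨Fin.elim0, fun i => i.elim0, fun i => i.elim0, fun i => i.elim0⟩
  | succ n ih =>
    have hU : U ≠ ⊥ := by rintro rfl; simp at hn
    obtain ⟨x, hx, hx0, α, β, hαβ, hdep⟩ := exists_dependent_functionals T hU
    have hxx := h x hx hx0 α β hαβ hdep
    have hxx' : ⟪T x, x⟫_ℂ ≠ 0 := by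
      rw [← inner_conj_symm, Complex.star_def.symm]
      exact star_ne_zero.2 hxx
    -- Evaluating the dependence at `x` excludes `α = 0`, so the kernel of `⟪x, T ·⟫` in `U` is
    -- form-orthogonal to `x` on both sides.
    have hα : α ≠ 0 := by
      rintro rfl
      have := hdep x hx
      rw [zero_mul, eq_comm, mul_eq_zero] at this
      exact hαβ.elim (fun h => h rfl) (fun h => this.elim h hxx)
    set f : E →ₗ[ℂ] ℂ := (innerSL ℂ x).toLinearMap ∘ₗ T with hf
    have hfa : ∀ y, f y = ⟪x, T y⟫_ℂ := fun _ => rfl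
    have hmem : ∀ y ∈ U ⊓ LinearMap.ker f, ⟪x, T y⟫_ℂ = 0 ∧ ⟪T x, y⟫_ℂ = 0 := by
      rintro y ⟨hy, hy0⟩
      have h0 : ⟪x, T y⟫_ℂ = 0 := hy0
      exact ⟨h0, by simpa [h0, hα] using hdep y hy⟩
    have hdim : Module.finrank ℂ ↥(U ⊓ LinearMap.ker f) = n := by
      have h1 := U.finrank_le_finrank_inf_ker_add_one f
      have h2 : Module.finrank ℂ ↥(U ⊓ LinearMap.ker f) < Module.finrank ℂ U :=
        Submodule.finrank_lt_finrank_of_lt (inf_le_left.lt_of_not_ge fun hle =>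
          hxx (hmem x (hle hx)).1)
      omega
    obtain ⟨b, hbU, hb, hb0⟩ := ih (U ⊓ LinearMap.ker f) hdim (by
      intro x' hx' hx0' α' β' hαβ' hdep'
      refine h x' hx'.1 hx0' α' β' hαβ' fun y hy => ?_
      -- A dependence on the complement extends to `U`: the component of `y` along `x` pairs to zero
      -- with `x'` on both sides.
      set s := ⟪x, T y⟫_ℂ / ⟪x, T x⟫_ℂ with hs
      have h1 := hdep' (y - s • x) ⟨U.sub_mem hy (U.smul_mem _ hx), by
        change f (y - s • x) = 0
        rw [map_sub, map_smul, hfa, hfa, smul_eq_mul, hs,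
          div_mul_cancel₀ _ hxx, sub_self]⟩
      have h2 : ⟪T x', x⟫_ℂ = 0 := by rw [← inner_conj_symm, (hmem x' hx').1, map_zero]
      have h3 : ⟪x', T x⟫_ℂ = 0 := by rw [← inner_conj_symm, (hmem x' hx').2, map_zero]
      simpa [inner_sub_right, inner_smul_right, h2, h3] using h1)
    refine ⟨Fin.cons x b, ?_, ?_, ?_⟩
    · exact Fin.cases hx fun i => (hbU i).1
    · refine Fin.cases (Fin.cases (fun h => absurd rfl h) fun j _ => ?_)
        fun i => Fin.cases (fun _ => ?_) fun j hij => ?_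
      · exact (hmem _ (hbU j)).1
      · simp only [Fin.cons_succ, Fin.cons_zero]
        rw [← inner_conj_symm, (hmem _ (hbU i)).2, map_zero]
      · exact hb i j fun he => hij (he ▸ rfl)
    · exact Fin.cases hxx fun i => hb0 i

/-- The coordinate-free form of the Li-Sze theorem. -/
theorem NegDefBound.exists_isotropic {T : E →ₗ[ℂ] E} {U : Submodule ℂ E} {k : ℕ}
    (h : NegDefBound T U k) : ∃ V ≤ U, Module.finrank ℂ V = k ∧ IsTotallyIsotropic T V := by
  induction hn : Module.finrank ℂ U using Nat.strong_induction_on generalizing U k with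
  | _ n ih =>
  rcases k with _ | k
  · exact ⟨⊥, bot_le, by simp, fun x hx y hy => by simp [(Submodule.mem_bot ℂ).1 hx]⟩
  -- A dependent isotropic vector lowers both the dimension and `k`; if there is none, the form can
  -- be diagonalized.
  by_cases hiso : ∃ x ∈ U, x ≠ 0 ∧ (∃ α β : ℂ, (α ≠ 0 ∨ β ≠ 0) ∧
      ∀ y ∈ U, α * ⟪T x, y⟫_ℂ = β * ⟪x, T y⟫_ℂ) ∧ ⟪x, T x⟫_ℂ = 0
  · obtain ⟨x, hx, hx0, ⟨α, β, hαβ, hdep⟩, hxx⟩ := hiso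
    obtain ⟨U', hU', hxU', horth, hneg⟩ := h.exists_lt_of_isotropic hx hx0 hxx hαβ hdep
    have hlt : Module.finrank ℂ U' < Module.finrank ℂ U :=
      Submodule.finrank_lt_finrank_of_lt (lt_of_le_of_ne hU' fun he => hxU' (he ▸ hx))
    obtain ⟨V, hV, hVk, hVi⟩ := ih _ (hn ▸ hlt) hneg rfl
    refine ⟨V ⊔ Submodule.span ℂ {x}, sup_le (hV.trans hU') (by simpa using hx), ?_, ?_⟩
    · rw [Submodule.finrank_sup_span_singleton fun hxV => hxU' (hV hxV), hVk]
    · intro y hy z hz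
      obtain ⟨y₁, hy₁, y₂, hy₂, rfl⟩ := Submodule.mem_sup.1 hy
      obtain ⟨s, rfl⟩ := Submodule.mem_span_singleton.1 hy₂
      obtain ⟨z₁, hz₁, z₂, hz₂, rfl⟩ := Submodule.mem_sup.1 hz
      obtain ⟨t, rfl⟩ := Submodule.mem_span_singleton.1 hz₂
      have h1 : ⟪y₁, T x⟫_ℂ = 0 := by
        rw [← inner_conj_symm, (horth y₁ (hV hy₁)).1, map_zero]
      simp [hVi y₁ hy₁ z₁ hz₁, h1, (horth z₁ (hV hz₁)).2, hxx]
  · push Not at hiso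
    obtain ⟨b, hbU, hb, hb0⟩ := exists_form_orthogonal_family T n U hn
      fun x hx hx0 α β hαβ hdep => hiso x hx hx0 ⟨α, β, hαβ, hdep⟩
    exact h.exists_isotropic_of_orthogonal_family hn hbU hb hb0

end TotallyIsotropic

/-! ### Numerical ranges of compressions and the Li–Sze theorem -/

theorem dotProduct_star_self_eq_norm_sq {ι : Type*} [Fintype ι] (x : EuclideanSpace ℂ ι) :
    star x.ofLp ⬝ᵥ x.ofLp = (‖x‖ ^ 2 : ℝ) := by
  rw [dotProduct_comm, ← EuclideanSpace.inner_eq_star_dotProduct, inner_self_eq_norm_sq_to_K]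
  norm_cast

theorem exists_smul_dotProduct_star_self_eq_one {ι : Type*} [Fintype ι] {w : ι → ℂ} (hw : w ≠ 0) :
    ∃ c : ℂ, star (c • w) ⬝ᵥ (c • w) = 1 := by
  have h := dotProduct_star_self_eq_norm_sq (WithLp.toLp 2 w)
  have hn : ‖WithLp.toLp 2 w‖ ≠ 0 := by simpa using hw
  refine ⟨((‖WithLp.toLp 2 w‖⁻¹ : ℝ) : ℂ), ?_⟩
  simp only at h
  rw [star_smul, smul_dotProduct, dotProduct_smul, h, Complex.star_def, Complex.conj_ofReal]
  simp only [smul_eq_mul]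
  norm_cast
  field_simp

theorem isCompact_setOf_dotProduct_star_self_eq_one (ι : Type*) [Fintype ι] :
    IsCompact {x : ι → ℂ | star x ⬝ᵥ x = 1} := by
  refine (isCompact_closedBall (0 : ι → ℂ) 1).of_isClosed_subset
    (isClosed_eq (by fun_prop) continuous_const) fun x hx => ?_
  rw [mem_closedBall_zero_iff, pi_norm_le_iff_of_nonneg zero_le_one]
  intro i
  have h := dotProduct_star_self_eq_norm_sq (WithLp.toLp 2 x)
  simp only [show star x ⬝ᵥ x = 1 from hx, EuclideanSpace.norm_sq_eq] at h
  have h1 : ∑ i, ‖x i‖ ^ 2 = 1 := by exact_mod_cast h.symm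
  have h2 := Finset.single_le_sum (f := fun i => ‖x i‖ ^ 2) (fun i _ => sq_nonneg _)
    (Finset.mem_univ i)
  rw [h1] at h2
  exact (sq_le_one_iff₀ (norm_nonneg _)).1 h2

theorem isCompact_numericalRange {m : ℕ} (B : Matrix (Fin m) (Fin m) ℂ) :
    IsCompact (numericalRange B) := by
  convert (isCompact_setOf_dotProduct_star_self_eq_one (Fin m)).image
    (f := fun x => star x ⬝ᵥ (B *ᵥ x)) (by fun_prop) using 1
  ext z
  simp only [numericalRange, Set.mem_ofPred_eq, Set.mem_image, eq_comm]

theorem star_dotProduct_conjTranspose_mul_mul_mulVec {n m : ℕ} (A : Matrix (Fin n) (Fin n) ℂ)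
    (X : Matrix (Fin n) (Fin m) ℂ) (x y : Fin m → ℂ) :
    star x ⬝ᵥ ((Xᴴ * A * X) *ᵥ y) = star (X *ᵥ x) ⬝ᵥ (A *ᵥ (X *ᵥ y)) := by
  rw [← Matrix.mulVec_mulVec, ← Matrix.mulVec_mulVec, Matrix.dotProduct_mulVec,
    ← Matrix.star_mulVec]

theorem star_mulVec_dotProduct_mulVec {n m : ℕ} {X : Matrix (Fin n) (Fin m) ℂ}
    (hX : X ∈ isometryMatrices n m) (x y : Fin m → ℂ) :
    star (X *ᵥ x) ⬝ᵥ (X *ᵥ y) = star x ⬝ᵥ y := by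
  have h := star_dotProduct_conjTranspose_mul_mul_mulVec 1 X x y
  rw [Matrix.mul_one, show Xᴴ * X = 1 from hX, Matrix.one_mulVec, Matrix.one_mulVec] at h
  exact h.symm

/-- The right side involves `M` only through the projection `M * Mᴴ`, in a closed condition with `x`
on the compact unit sphere. This is the form in which density can be used. -/
theorem mem_numericalRange_compression_iff {n m : ℕ} {A : Matrix (Fin n) (Fin n) ℂ}
    {M : Matrix (Fin n) (Fin m) ℂ} (hM : M ∈ isometryMatrices n m) {l : ℂ} :
    l ∈ numericalRange (Mᴴ * A * M) ↔
      ∃ x : Fin n → ℂ, star x ⬝ᵥ x = 1 ∧ (M * Mᴴ) *ᵥ x = x ∧ star x ⬝ᵥ (A *ᵥ x) = l := by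
  constructor
  · rintro ⟨y, hy, rfl⟩
    refine ⟨M *ᵥ y, by rw [star_mulVec_dotProduct_mulVec hM, hy], ?_,
      (star_dotProduct_conjTranspose_mul_mul_mulVec A M y y).symm⟩
    rw [Matrix.mulVec_mulVec, Matrix.mul_assoc, show Mᴴ * M = 1 from hM, Matrix.mul_one]
  · rintro ⟨x, hx, hMx, rfl⟩
    have hMx' : M *ᵥ (Mᴴ *ᵥ x) = x := by rw [Matrix.mulVec_mulVec, hMx]
    refine ⟨Mᴴ *ᵥ x, ?_, ?_⟩
    · rw [← star_mulVec_dotProduct_mulVec hM, hMx', hx]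
    · rw [star_dotProduct_conjTranspose_mul_mul_mulVec, hMx']

theorem exists_isometryMatrices_of_finrank {n k : ℕ} {V : Submodule ℂ (EuclideanSpace ℂ (Fin n))}
    (hV : Module.finrank ℂ V = k) :
    ∃ X ∈ isometryMatrices n k, ∀ y : Fin k → ℂ, WithLp.toLp 2 (X *ᵥ y) ∈ V := by
  set b := (stdOrthonormalBasis ℂ V).reindex (finCongr hV)
  refine ⟨Matrix.of fun i j => (b j : EuclideanSpace ℂ (Fin n)) i, ?_, fun y => ?_⟩
  · change _ = _
    ext j l
    have h := orthonormal_iff_ite.1 b.orthonormal j l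
    rw [Submodule.coe_inner, EuclideanSpace.inner_eq_star_dotProduct, dotProduct_comm] at h
    rw [Matrix.one_apply, ← h]
    simp [Matrix.mul_apply, dotProduct]
  · have : WithLp.toLp 2 ((Matrix.of fun i j => (b j : EuclideanSpace ℂ (Fin n)) i) *ᵥ y) =
        ∑ j, y j • (b j : EuclideanSpace ℂ (Fin n)) := by
      ext i
      simp [Matrix.mulVec, dotProduct, mul_comm]
    rw [this]
    exact V.sum_mem fun j _ => V.smul_mem _ (b j).2

theorem Submodule.exists_le_finrank_eq {K V : Type*} [Field K] [AddCommGroup V] [Module K V]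
    {N : Submodule K V} {m : ℕ} (h : m ≤ Module.finrank K N) :
    ∃ W ≤ N, Module.finrank K W = m := by
  obtain ⟨f, hf⟩ := exists_linearIndependent_of_le_finrank h
  refine ⟨Submodule.span K (Set.range fun i => (f i : V)), ?_, ?_⟩
  · rw [Submodule.span_le]
    rintro _ ⟨i, rfl⟩
    exact (f i).2
  · exact (finrank_span_eq_card (hf.map' N.subtype N.ker_subtype)).trans (Fintype.card_fin m)

theorem inner_toLp_toEuclideanLin {n : ℕ} (B : Matrix (Fin n) (Fin n) ℂ) (x y : Fin n → ℂ) :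
    ⟪WithLp.toLp 2 x, Matrix.toEuclideanLin B (WithLp.toLp 2 y)⟫_ℂ = star x ⬝ᵥ (B *ᵥ y) := by
  rw [EuclideanSpace.inner_eq_star_dotProduct, dotProduct_comm]
  rfl

/-- The Li-Sze theorem. -/
theorem mem_rankNumericalRange_iff {n k : ℕ} (hkn : k ≤ n) {A : Matrix (Fin n) (Fin n) ℂ} {l : ℂ} :
    l ∈ rankNumericalRange k A ↔
      ∀ M ∈ isometryMatrices n (n - k + 1), l ∈ numericalRange (Mᴴ * A * M) := by
  constructor
  · rintro ⟨X, hX, hXl⟩ M hM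
    have hinj : ∀ {m : ℕ} {Y : Matrix (Fin n) (Fin m) ℂ}, Y ∈ isometryMatrices n m →
        Module.finrank ℂ (LinearMap.range Y.mulVecLin) = m := by
      intro m Y hY
      rw [LinearMap.finrank_range_of_inj, Module.finrank_fin_fun]
      intro v w hvw
      have h := congrArg (Yᴴ *ᵥ ·) hvw
      simpa [show Yᴴ * Y = 1 from hY] using h
    -- The dimensions `k` and `n - k + 1` add up to `n + 1`.
    have hne : LinearMap.range X.mulVecLin ⊓ LinearMap.range M.mulVecLin ≠ ⊥ := by
      intro h0
      have h1 := Submodule.finrank_sup_add_finrank_inf_eq (LinearMap.range X.mulVecLin)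
        (LinearMap.range M.mulVecLin)
      have h2 := Submodule.finrank_le (LinearMap.range X.mulVecLin ⊔ LinearMap.range M.mulVecLin)
      rw [h0, finrank_bot, hinj hX, hinj hM] at h1
      rw [Module.finrank_fin_fun] at h2
      omega
    obtain ⟨w, hw, hw0⟩ := Submodule.exists_mem_ne_zero_of_ne_bot hne
    obtain ⟨c, hc⟩ := exists_smul_dotProduct_star_self_eq_one hw0
    obtain ⟨⟨z, hz⟩, ⟨y, hy⟩⟩ := Submodule.smul_mem _ c hw
    rw [Matrix.mulVecLin_apply] at hz hy
    refine ⟨y, ?_, ?_⟩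
    · rw [← star_mulVec_dotProduct_mulVec hM, hy, hc]
    · rw [star_dotProduct_conjTranspose_mul_mul_mulVec, hy, ← hz,
        ← star_dotProduct_conjTranspose_mul_mul_mulVec, hXl, Matrix.smul_mulVec,
        Matrix.one_mulVec, dotProduct_smul, ← star_mulVec_dotProduct_mulVec hX, hz, hc, smul_eq_mul,
        mul_one]
  · intro h
    set B := A - l • (1 : Matrix (Fin n) (Fin n) ℂ) with hB
    -- A negative definite subspace that is too large contains the range of some isometry `M` with
    -- `n - k + 1` columns. Since `l` lies in the numerical range of that compression, the form of
    -- `B` vanishes at a unit vector of this range.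
    have hneg : NegDefBound (Matrix.toEuclideanLin B) ⊤ k := by
      intro c N _ hN
      by_contra hlt
      rw [finrank_top, finrank_euclideanSpace_fin] at hlt
      obtain ⟨W, hWN, hW⟩ := Submodule.exists_le_finrank_eq
        (show n - k + 1 ≤ Module.finrank ℂ N by omega)
      obtain ⟨M, hM, hMW⟩ := exists_isometryMatrices_of_finrank hW
      obtain ⟨y, hy, hyl⟩ := h M hM
      have hMy := star_mulVec_dotProduct_mulVec hM y y
      have h0 : star (M *ᵥ y) ⬝ᵥ (B *ᵥ (M *ᵥ y)) = 0 := by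
        rw [hB, Matrix.sub_mulVec, dotProduct_sub, Matrix.smul_mulVec, Matrix.one_mulVec,
          dotProduct_smul, hMy, hy, ← star_dotProduct_conjTranspose_mul_mul_mulVec, ← hyl]
        simp
      have h1 := hN _ (hWN (hMW y)) (by
        intro h2
        have h3 : M *ᵥ y = 0 := by simpa using h2
        rw [h3, hy] at hMy
        simp at hMy)
      rw [inner_toLp_toEuclideanLin, h0] at h1
      simp at h1
    obtain ⟨V, -, hVk, hV⟩ := hneg.exists_isotropic
    obtain ⟨X, hX, hXV⟩ := exists_isometryMatrices_of_finrank hVk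
    refine ⟨X, hX, ?_⟩
    have h0 : Xᴴ * B * X = 0 := by
      ext i j
      have h1 := hV _ (hXV (Pi.single i 1)) _ (hXV (Pi.single j 1))
      rw [inner_toLp_toEuclideanLin, ← star_dotProduct_conjTranspose_mul_mul_mulVec] at h1
      simpa [← Pi.single_star] using h1
    rw [hB, Matrix.mul_sub, Matrix.sub_mul, sub_eq_zero] at h0
    rw [h0, Matrix.mul_smul, Matrix.mul_one, Matrix.smul_mul, show Xᴴ * X = 1 from hX]

/-! ### Sequences with dense projections -/

theorem rankNumericalRange_eq_iInter_of_hasDenseProjections {n k : ℕ} (hkn : k ≤ n)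
    {M : ℕ → Matrix (Fin n) (Fin (n - k + 1)) ℂ} (hM : ∀ p, M p ∈ isometryMatrices n (n - k + 1))
    (hd : HasDenseProjections M) (A : Matrix (Fin n) (Fin n) ℂ) :
    rankNumericalRange k A = ⋂ p, numericalRange ((M p)ᴴ * A * M p) := by
  ext l
  rw [mem_rankNumericalRange_iff hkn, Set.mem_iInter]
  refine ⟨fun h p => h _ (hM p), fun h N hN => ?_⟩
  have hc := isClosed_setOf_exists_mem_isCompact
    (isCompact_setOf_dotProduct_star_self_eq_one (Fin n))
    (s := {q : Matrix (Fin n) (Fin n) ℂ × (Fin n → ℂ) |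
      q.1 *ᵥ q.2 = q.2 ∧ star q.2 ⬝ᵥ (A *ᵥ q.2) = l})
    ((isClosed_eq (by fun_prop) (by fun_prop)).inter (isClosed_eq (by fun_prop) continuous_const))
  rw [mem_numericalRange_compression_iff hN]
  refine closure_minimal ?_ hc (hd ⟨N, hN, rfl⟩)
  rintro _ ⟨p, rfl⟩
  exact (mem_numericalRange_compression_iff (hM p)).1 (h p)

theorem exists_hasDenseProjections {n m : ℕ} (hmn : m ≤ n) :
    ∃ M : ℕ → Matrix (Fin n) (Fin m) ℂ,
      (∀ p, M p ∈ isometryMatrices n m) ∧ HasDenseProjections M := by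
  obtain ⟨W, -, hW⟩ := Submodule.exists_le_finrank_eq
    (show m ≤ Module.finrank ℂ (⊤ : Submodule ℂ (EuclideanSpace ℂ (Fin n))) by simpa using hmn)
  obtain ⟨X, hX, -⟩ := exists_isometryMatrices_of_finrank hW
  have : Nonempty (rankProjections n m) := ⟨⟨_, X, hX, rfl⟩⟩
  have : SecondCountableTopology (Matrix (Fin n) (Fin n) ℂ) :=
    inferInstanceAs (SecondCountableTopology (Fin n → Fin n → ℂ))
  choose M hM hM' using fun p => (TopologicalSpace.denseSeq (rankProjections n m) p).2
  refine ⟨M, hM, fun P hP => ?_⟩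
  have h := (TopologicalSpace.denseRange_denseSeq (rankProjections n m)) ⟨P, hP⟩
  have h1 := image_closure_subset_closure_image continuous_subtype_val
    (Set.mem_image_of_mem Subtype.val h)
  convert h1 using 2
  rw [← Set.range_comp]
  exact congrArg _ (funext fun p => (hM' p).symm)

/-! ### Maximal modulus and decreasing compact sets -/

theorem IsCompact.exists_mem_frontier_isGreatest_norm {K : Set ℂ} (hK : IsCompact K)
    (hne : K.Nonempty) : ∃ z ∈ frontier K, ∀ w ∈ K, ‖w‖ ≤ ‖z‖ := by
  obtain ⟨z, hz, hmax⟩ := hK.exists_isMaxOn hne continuous_norm.continuousOn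
  refine ⟨z, ?_, fun w hw => hmax hw⟩
  rw [hK.isClosed.frontier_eq]
  refine ⟨hz, fun hint => ?_⟩
  obtain ⟨η, hη, hball⟩ := Metric.isOpen_iff.1 isOpen_interior z hint
  -- If a point of maximal modulus were interior, moving it outward along the unit direction `u`
  -- would increase the modulus; for `z = 0` any direction serves.
  obtain ⟨u, hu, huz⟩ : ∃ u : ℂ, ‖u‖ = 1 ∧ z = ‖z‖ * u := by
    rcases eq_or_ne z 0 with rfl | h0
    · exact ⟨1, by simp, by simp⟩
    · have : (‖z‖ : ℂ) ≠ 0 := by simpa using h0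
      exact ⟨z / ‖z‖, by simp [h0], by field_simp⟩
  have h1 : z + (η / 2 : ℝ) * u ∈ K := interior_subset (hball (by
    rw [Metric.mem_ball, dist_eq_norm, add_sub_cancel_left, norm_mul, hu, Complex.norm_real,
      Real.norm_of_nonneg (by positivity)]
    linarith))
  have h2 : ‖z + (η / 2 : ℝ) * u‖ = ‖z‖ + η / 2 := by
    conv_lhs => rw [huz, ← add_mul, norm_mul, hu, mul_one, ← Complex.ofReal_add,
      Complex.norm_real, Real.norm_of_nonneg (by positivity)]
  have h3 : ‖z + (η / 2 : ℝ) * u‖ ≤ ‖z‖ := hmax h1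
  linarith

theorem IsCompact.sSup_norm_image_frontier {K : Set ℂ} (hK : IsCompact K) :
    sSup ((fun z : ℂ => ‖z‖) '' frontier K) = sSup ((fun z : ℂ => ‖z‖) '' K) := by
  rcases K.eq_empty_or_nonempty with rfl | hne
  · simp
  · obtain ⟨z, hz, hmax⟩ := hK.exists_mem_frontier_isGreatest_norm hne
    have h1 : IsGreatest ((fun z : ℂ => ‖z‖) '' frontier K) ‖z‖ :=
      ⟨⟨z, hz, rfl⟩, by rintro _ ⟨w, hw, rfl⟩; exact hmax w (hK.isClosed.frontier_subset hw)⟩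
    have h2 : IsGreatest ((fun z : ℂ => ‖z‖) '' K) ‖z‖ :=
      ⟨⟨z, hK.isClosed.frontier_subset hz, rfl⟩, by rintro _ ⟨w, hw, rfl⟩; exact hmax w hw⟩
    rw [h1.csSup_eq, h2.csSup_eq]

theorem sSup_norm_image_mono {J K : Set ℂ} (hK : BddAbove ((fun z : ℂ => ‖z‖) '' K))
    (h : J ⊆ K) : sSup ((fun z : ℂ => ‖z‖) '' J) ≤ sSup ((fun z : ℂ => ‖z‖) '' K) := by
  rcases J.eq_empty_or_nonempty with rfl | hne
  · simp only [Set.image_empty, Real.sSup_empty]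
    exact Real.sSup_nonneg (by rintro _ ⟨w, -, rfl⟩; exact norm_nonneg w)
  · exact csSup_le_csSup hK (hne.image _) (Set.image_mono h)

/-- The supremum of the norm is continuous along a decreasing sequence of compact sets, also if the
sets become empty. -/
theorem tendsto_sSup_norm_image_of_antitone {J : ℕ → Set ℂ} (hJ : Antitone J)
    (hc : ∀ ν, IsCompact (J ν)) :
    Filter.Tendsto (fun ν => sSup ((fun z : ℂ => ‖z‖) '' J ν)) Filter.atTop
      (nhds (sSup ((fun z : ℂ => ‖z‖) '' ⋂ ν, J ν))) := by
  have hb : ∀ ν, BddAbove ((fun z : ℂ => ‖z‖) '' J ν) := fun ν =>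
    ((hc ν).image continuous_norm).bddAbove
  have hnn : ∀ s : Set ℂ, 0 ≤ sSup ((fun z : ℂ => ‖z‖) '' s) := fun s =>
    Real.sSup_nonneg (by rintro _ ⟨w, -, rfl⟩; exact norm_nonneg w)
  have hle : ∀ ν, sSup ((fun z : ℂ => ‖z‖) '' ⋂ ν, J ν) ≤ sSup ((fun z : ℂ => ‖z‖) '' J ν) :=
    fun ν => sSup_norm_image_mono (hb ν) (Set.iInter_subset _ ν)
  rw [Metric.tendsto_atTop]
  intro η hη
  set L := sSup ((fun z : ℂ => ‖z‖) '' ⋂ ν, J ν) with hL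
  obtain ⟨ν₀, hν₀⟩ : ∃ ν₀, sSup ((fun z : ℂ => ‖z‖) '' J ν₀) < L + η := by
    by_contra! hcon
    -- The supremum over the empty set is `0`, so positivity of `L + η` forces every `J ν` to be
    -- nonempty. Each then has a point of modulus at least `L + η`, and by compactness so does the
    -- intersection.
    have hLη : 0 < L + η := by linarith [hnn (⋂ ν, J ν)]
    have hclosed : IsClosed {z : ℂ | L + η ≤ ‖z‖} := isClosed_le continuous_const continuous_norm
    obtain ⟨z, hz⟩ := IsCompact.nonempty_iInter_of_sequence_nonempty_isCompact_isClosed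
      (fun ν => J ν ∩ {z : ℂ | L + η ≤ ‖z‖})
      (fun ν => Set.inter_subset_inter_left _ (hJ (Nat.le_succ ν)))
      (fun ν => by
        have hne : (J ν).Nonempty := by
          by_contra h0
          have := hcon ν
          rw [Set.not_nonempty_iff_eq_empty.1 h0, Set.image_empty, Real.sSup_empty] at this
          linarith
        obtain ⟨z, hz, hzs⟩ := ((hc ν).image continuous_norm).sSup_mem (hne.image _)
        exact ⟨z, hz, by simpa [hzs] using hcon ν⟩)
      ((hc 0).inter_right hclosed) (fun ν => (hc ν).isClosed.inter hclosed)
    rw [Set.mem_iInter] at hz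
    have h1 : ‖z‖ ≤ L := le_csSup ((hb 0).mono (Set.image_mono (Set.iInter_subset _ 0)))
      ⟨z, Set.mem_iInter.2 fun ν => (hz ν).1, rfl⟩
    have h2 : L + η ≤ ‖z‖ := (hz 0).2
    linarith
  refine ⟨ν₀, fun ν hν => ?_⟩
  rw [Real.dist_eq, abs_of_nonneg (sub_nonneg.2 (hle ν))]
  linarith [sSup_norm_image_mono (hb ν₀) (hJ hν)]

theorem theorem3p1 (n k : ℕ) (hk : 1 ≤ k) (hkn : k ≤ n) :
    (∃ M : ℕ → Matrix (Fin n) (Fin (n - k + 1)) ℂ,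
      (∀ p, M p ∈ isometryMatrices n (n - k + 1)) ∧ HasDenseProjections M) ∧
    ∀ M : ℕ → Matrix (Fin n) (Fin (n - k + 1)) ℂ,
      (∀ p, M p ∈ isometryMatrices n (n - k + 1)) →
      ∀ A : Matrix (Fin n) (Fin n) ℂ,
        (HasDenseProjections M ∨
          rankNumericalRange k A = ⋂ p, numericalRange ((M p)ᴴ * A * M p)) →
        rankNumericalRange k A = ⋂ p, numericalRange ((M p)ᴴ * A * M p) ∧
        ((rankNumericalRange k A).Nonempty →
          IsGreatest ((fun z : ℂ => ‖z‖) '' frontier (rankNumericalRange k A))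
            (rankNumericalRadius k A)) ∧
        (∀ ν, BddAbove ((fun z : ℂ => ‖z‖) '' compressionIntersection M A ν)) ∧
        Filter.Tendsto (compressionRadius M A) Filter.atTop (nhds (rankNumericalRadius k A)) ∧
        IsGLB (Set.range (compressionRadius M A)) (rankNumericalRadius k A) := by
  refine ⟨exists_hasDenseProjections (by omega), fun M hM A hor => ?_⟩
  have heq : rankNumericalRange k A = ⋂ p, numericalRange ((M p)ᴴ * A * M p) :=
    hor.elim (fun hd => rankNumericalRange_eq_iInter_of_hasDenseProjections hkn hM hd A) id
  have hc : ∀ p, IsCompact (numericalRange ((M p)ᴴ * A * M p)) := fun p =>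
    isCompact_numericalRange _
  have hJc : ∀ ν, IsCompact (compressionIntersection M A ν) := fun ν =>
    (hc 0).of_isClosed_subset
      (isClosed_iInter fun p => isClosed_iInter fun _ => (hc p).isClosed)
      (Set.iInter₂_subset 0 (Nat.zero_le ν))
  have hJ : Antitone (compressionIntersection M A) := fun ν ν' hν =>
    Set.iInter₂_mono' fun p hp => ⟨p, hp.trans hν, subset_rfl⟩
  have hJi : ⋂ ν, compressionIntersection M A ν = rankNumericalRange k A := by
    rw [heq]
    ext z
    simp only [compressionIntersection, Set.mem_iInter]
    exact ⟨fun h p => h p p le_rfl, fun h _ p _ => h p⟩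
  have hK : IsCompact (rankNumericalRange k A) := hJi ▸ (hJc 0).of_isClosed_subset
    (isClosed_iInter fun ν => (hJc ν).isClosed) (Set.iInter_subset _ 0)
  have hb : ∀ ν, BddAbove ((fun z : ℂ => ‖z‖) '' compressionIntersection M A ν) := fun ν =>
    ((hJc ν).image continuous_norm).bddAbove
  have ht : Filter.Tendsto (compressionRadius M A) Filter.atTop
      (nhds (rankNumericalRadius k A)) := by
    -- The radius is defined on the boundary, but for a compact set the supremum over the whole set
    -- is the same, also when the set is empty.
    rw [rankNumericalRadius, hK.sSup_norm_image_frontier, ← hJi]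
    exact tendsto_sSup_norm_image_of_antitone hJ hJc
  refine ⟨heq, fun hne => ?_, hb, ht,
    isGLB_of_tendsto_atTop (fun ν ν' hν => sSup_norm_image_mono (hb ν) (hJ hν)) ht⟩
  obtain ⟨z, hz, hmax⟩ := hK.exists_mem_frontier_isGreatest_norm hne
  have h1 : IsGreatest ((fun z : ℂ => ‖z‖) '' frontier (rankNumericalRange k A)) ‖z‖ :=
    ⟨⟨z, hz, rfl⟩, by rintro _ ⟨w, hw, rfl⟩; exact hmax w (hK.isClosed.frontier_subset hw)⟩
  rw [rankNumericalRadius, h1.csSup_eq]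
  exact h1

end
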